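/- A binary $[n,k,d]$ code is a $k$-dimensional linear subspace $C$ of $\mathbb{F}_2^n$ whose minimum weight, that is, the smallest number of non-zero coordinates of a non-zero vector of $C$, equals $d$. Its dual is $C^\perp=\{x\in\mathbb{F}_2^n \mid x\cdot y=0 \text{ for all } y\in C\}$, where $x\cdot y$ is the standard inner product, and $C$ is called linear complementary dual (LCD) if $C\cap C^\perp=\{0\}$. There is no binary LCD $[n,4,d]$ code for $$(n,d)=(22,11),\ (23,12),\ (26,13),\ (27,14),\ (30,16),\ (30,15),\ (31,16).$$ -/

import Mathlib

/-- A binary linear code of length `n`: a linear subspace of `𝔽₂ⁿ`. -/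
abbrev BinaryCode (n : ℕ) : Type := Submodule (ZMod 2) (Fin n → ZMod 2)

namespace BinaryCode

/-- The dual code `C^⊥ = {x | x · y = 0 for all y ∈ C}` for the standard inner product. -/
def dual {n : ℕ} (C : BinaryCode n) : BinaryCode n where
  carrier := {x | ∀ y ∈ C, x ⬝ᵥ y = 0}
  zero_mem' := fun y _ => zero_dotProduct y
  add_mem' := fun {a b} ha hb y hy => by rw [add_dotProduct, ha y hy, hb y hy, add_zero]
  smul_mem' := fun c x hx y hy => by rw [smul_dotProduct, hx y hy, smul_zero]

/-- A code is linear complementary dual (LCD) if `C ∩ C^⊥ = {0}`. -/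
def IsLCD {n : ℕ} (C : BinaryCode n) : Prop := C ⊓ C.dual = ⊥

/-- `d` is the minimum weight of `C`: the least Hamming weight of a nonzero codeword.
The zero code has no minimum weight. -/
def HasMinWeight {n : ℕ} (C : BinaryCode n) (d : ℕ) : Prop :=
  IsLeast {w : ℕ | ∃ x ∈ C, x ≠ 0 ∧ hammingNorm x = w} d

/-- `C` is an `[n, k, d]` code: it has length `n`, dimension `k` and minimum weight `d`. -/
def HasParams {n : ℕ} (C : BinaryCode n) (k d : ℕ) : Prop :=
  Module.finrank (ZMod 2) C = k ∧ C.HasMinWeight d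

end BinaryCode

/-! Choose a generator matrix with columns `g`. LCD says that its Gram form is nonsingular, so it
suffices to find a nonzero vector in the radical. Since `wt x + wt y - wt (x + y)` is twice the
overlap of the supports, the weights mod 4 determine the form. For an even code with parameters
(23,12), (27,14) or (31,16), write the weights as `d + 2 f x`. The total weight leaves at most 4 for
`∑ f`, and divisibility on hyperplane complements gives `∑ f x • x = 0`. So `f` counts a tiny
zero-sum multiset, and in each case the radical has dimension at least 2
(`exists_pair_colGram_eq_zero`). Lengths 22, 26, 30 follow by adding a parity bit, which costs at
most one dimension of radical. A non-even code of length 23, 27 or 31 survives the count only at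
(31,16), with all weights forced. -/

namespace BinaryCode

open Finset

/-! ### Weights and the Gram form in terms of generator columns -/

section Columns

variable {ι : Type*} [Fintype ι]

/-- The weight of the codeword with message `x` in the code whose generator matrix has
columns `g`. -/
def colWeight (g : ι → Fin 4 → ZMod 2) (x : Fin 4 → ZMod 2) : ℕ := #{i | g i ⬝ᵥ x ≠ 0}

/-- The Gram form of the code whose generator matrix has columns `g`. -/
def colGram (g : ι → Fin 4 → ZMod 2) (x y : Fin 4 → ZMod 2) : ZMod 2 :=
  ∑ i, (g i ⬝ᵥ x) * (g i ⬝ᵥ y)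

lemma colWeight_eq_sum (g : ι → Fin 4 → ZMod 2) (x : Fin 4 → ZMod 2) :
    colWeight g x = ∑ i, if g i ⬝ᵥ x ≠ 0 then 1 else 0 := by
  rw [colWeight, card_filter]

lemma colGram_eq_card (g : ι → Fin 4 → ZMod 2) (x y : Fin 4 → ZMod 2) :
    colGram g x y = (#{i | g i ⬝ᵥ x ≠ 0 ∧ g i ⬝ᵥ y ≠ 0} : ℕ) := by
  rw [colGram, card_filter, Nat.cast_sum]
  refine sum_congr rfl fun i _ => ?_
  generalize g i ⬝ᵥ x = a
  generalize g i ⬝ᵥ y = b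
  revert a b
  decide

lemma two_mul_card_add_colWeight_add (g : ι → Fin 4 → ZMod 2) (x y : Fin 4 → ZMod 2) :
    2 * #{i | g i ⬝ᵥ x ≠ 0 ∧ g i ⬝ᵥ y ≠ 0} + colWeight g (x + y) =
      colWeight g x + colWeight g y := by
  simp only [colWeight_eq_sum, card_filter, mul_sum, ← sum_add_distrib, dotProduct_add]
  refine sum_congr rfl fun i _ => ?_
  generalize g i ⬝ᵥ x = a
  generalize g i ⬝ᵥ y = b
  revert a b
  decide

lemma colGram_eq_zero_of_dvd {g : ι → Fin 4 → ZMod 2} {x y : Fin 4 → ZMod 2}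
    (h : colWeight g x + colWeight g y ≡ colWeight g (x + y) [MOD 4]) : colGram g x y = 0 := by
  rw [colGram_eq_card, ZMod.natCast_eq_zero_iff]
  have := two_mul_card_add_colWeight_add g x y
  unfold Nat.ModEq at h
  omega

@[simp] lemma colWeight_zero (g : ι → Fin 4 → ZMod 2) : colWeight g 0 = 0 := by
  simp [colWeight]

@[simp] lemma colGram_zero_right (g : ι → Fin 4 → ZMod 2) (x : Fin 4 → ZMod 2) :
    colGram g x 0 = 0 := by
  simp [colGram]

lemma colGram_add_left (g : ι → Fin 4 → ZMod 2) (x x' y : Fin 4 → ZMod 2) :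
    colGram g (x + x') y = colGram g x y + colGram g x' y := by
  simp only [colGram, dotProduct_add, add_mul, sum_add_distrib]

lemma natCast_colWeight (g : ι → Fin 4 → ZMod 2) (x : Fin 4 → ZMod 2) :
    (colWeight g x : ZMod 2) = (∑ i, g i) ⬝ᵥ x := by
  rw [colWeight_eq_sum, Nat.cast_sum, sum_dotProduct]
  refine sum_congr rfl fun i _ => ?_
  generalize g i ⬝ᵥ x = a
  revert a
  decide

lemma even_colWeight_iff (g : ι → Fin 4 → ZMod 2) (x : Fin 4 → ZMod 2) :
    Even (colWeight g x) ↔ (∑ i, g i) ⬝ᵥ x = 0 := by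
  rw [← natCast_colWeight, ZMod.natCast_eq_zero_iff_even]

lemma card_dotProduct_ne_zero :
    ∀ v : Fin 4 → ZMod 2, v ≠ 0 → #{x | v ⬝ᵥ x ≠ 0} = 8 := by
  decide +kernel

lemma four_dvd_card_dotProduct_ne_zero :
    ∀ v a : Fin 4 → ZMod 2, 4 ∣ #{x | v ⬝ᵥ x ≠ 0 ∧ a ⬝ᵥ x ≠ 0} := by
  decide +kernel

lemma add_self_eq_zero_vec (x : Fin 4 → ZMod 2) : x + x = 0 := CharTwo.add_self_eq_zero x

/-- Double counting: each nonzero column is nonzero on exactly 8 messages. -/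
lemma sum_colWeight (g : ι → Fin 4 → ZMod 2) :
    ∑ x, colWeight g x + 8 * #{i | g i = 0} = 8 * Fintype.card ι := by
  simp only [colWeight_eq_sum]
  rw [sum_comm, card_filter, mul_sum, ← sum_add_distrib, ← card_univ, card_eq_sum_ones, mul_sum]
  refine sum_congr rfl fun i _ => ?_
  rw [← card_filter]
  by_cases h : g i = 0
  · simp [h]
  · simp [h, card_dotProduct_ne_zero (g i) h]

lemma four_dvd_sum_colWeight (g : ι → Fin 4 → ZMod 2) (v : Fin 4 → ZMod 2) :
    4 ∣ ∑ x with v ⬝ᵥ x ≠ 0, colWeight g x := by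
  simp only [colWeight_eq_sum]
  rw [sum_comm]
  refine dvd_sum fun i _ => ?_
  rw [← card_filter, filter_filter]
  exact four_dvd_card_dotProduct_ne_zero v (g i)

/-- For an even code with weights `d + 2 * f x`, the vectors counted with multiplicity `f`
sum to zero. -/
lemma sum_nsmul_eq_zero {g : ι → Fin 4 → ZMod 2} {d : ℕ}
    {f : (Fin 4 → ZMod 2) → ℕ} (hf : ∀ x ≠ 0, colWeight g x = d + 2 * f x) :
    ∑ x, f x • x = 0 := by
  have key (v : Fin 4 → ZMod 2) : v ⬝ᵥ ∑ x, f x • x = 0 := by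
    by_cases hv : v = 0
    · simp [hv]
    have h1 : ∑ x with v ⬝ᵥ x ≠ 0, colWeight g x =
        8 * d + 2 * ∑ x with v ⬝ᵥ x ≠ 0, f x := by
      rw [← card_dotProduct_ne_zero v hv, mul_sum, card_eq_sum_ones, sum_mul, ← sum_add_distrib]
      refine sum_congr rfl fun x hx => ?_
      rw [hf x, one_mul]
      rintro rfl
      simp at hx
    have h2 := four_dvd_sum_colWeight g v
    have h3 : 2 ∣ ∑ x with v ⬝ᵥ x ≠ 0, f x := by omega
    rw [← ZMod.natCast_eq_zero_iff, sum_filter, Nat.cast_sum] at h3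
    rw [dotProduct_sum, ← h3]
    refine sum_congr rfl fun x _ => ?_
    rw [dotProduct_smul, nsmul_eq_mul]
    generalize v ⬝ᵥ x = a
    generalize f x = m
    obtain rfl | rfl : a = 0 ∨ a = 1 := by revert a; decide
    · simp
    · simp
  -- Zero pairing with the unit vectors kills every coordinate.
  ext j
  simpa using key (Pi.single j 1)

end Columns

/-! ### Short zero-sum multisets -/

lemma vec_add_eq_iff (u x y : Fin 4 → ZMod 2) : u + y = x ↔ y = u + x := by
  constructor <;> rintro rfl <;> rw [← add_assoc, add_self_eq_zero_vec, zero_add]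

/-- Translation by `a + b` swaps `a` with `b` and `c` with `a + b + c`. -/
lemma count_add_of_plane (a b c y : Fin 4 → ZMod 2) :
    Multiset.count (a + b + y) {a, b, c, a + b + c} = Multiset.count y {a, b, c, a + b + c} := by
  have ha : a + b + a = b := by rw [add_right_comm, add_self_eq_zero_vec, zero_add]
  have hb : a + b + b = a := by rw [add_assoc, add_self_eq_zero_vec, add_zero]
  have hc : a + b + (a + b + c) = c := by rw [← add_assoc, add_self_eq_zero_vec, zero_add]
  simp only [Multiset.insert_eq_cons, Multiset.count_cons, Multiset.count_singleton,
    vec_add_eq_iff, ha, hb, hc]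
  ring

lemma count_of_plane_eq_zero {a b c : Fin 4 → ZMod 2}
    (h0 : 0 ∉ ({a, b, c, a + b + c} : Multiset (Fin 4 → ZMod 2))) :
    Multiset.count (a + b) {a, b, c, a + b + c} = 0 := by
  have h := count_add_of_plane a b c 0
  rw [add_zero] at h
  exact h.trans (Multiset.count_eq_zero.2 h0)

/-- A short multiset of nonzero vectors summing to zero admits two nonzero vectors at which the
form it induces vanishes. -/
lemma exists_pair_of_sum_eq_zero {s : Multiset (Fin 4 → ZMod 2)} {t : ℕ} (h0 : 0 ∉ s)
    (hs : s.sum = 0) (ht : t = 6 ∧ s.card = 2 ∨ t = 7 ∧ s.card = 3 ∨ t = 8 ∧ s.card = 0 ∨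
      t = 8 ∧ s.card = 4) :
    ∃ a b : Fin 4 → ZMod 2, a ≠ 0 ∧ b ≠ 0 ∧ a ≠ b ∧ ∀ u, u = a ∨ u = b →
      ∀ y, y ≠ 0 → y ≠ u → Even (t + s.count u + s.count y + s.count (u + y)) := by
  -- If `t` and all multiplicities are even, any two distinct nonzero vectors serve.
  have triv (h6 : Even t) (hE : ∀ x, Even (s.count x)) : ∃ a b : Fin 4 → ZMod 2, a ≠ 0 ∧ b ≠ 0 ∧
      a ≠ b ∧ ∀ u, u = a ∨ u = b →
      ∀ y, y ≠ 0 → y ≠ u → Even (t + s.count u + s.count y + s.count (u + y)) :=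
    ⟨Pi.single 0 1, Pi.single 1 1, by decide, by decide, by decide, fun u _ y _ _ =>
      ((h6.add (hE _)).add (hE _)).add (hE _)⟩
  have eq_of (x y : Fin 4 → ZMod 2) (h : x + y = 0) : x = y := by
    rwa [CharTwo.add_eq_zero] at h
  have dbl (x y : Fin 4 → ZMod 2) : Even (Multiset.count y {x, x}) := by
    by_cases h : y = x <;> simp [Multiset.insert_eq_cons, h]
  rcases ht with ⟨rfl, hc⟩ | ⟨rfl, hc⟩ | ⟨rfl, hc⟩ | ⟨rfl, hc⟩
  · obtain ⟨a, b, rfl⟩ := Multiset.card_eq_two.1 hc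
    obtain rfl : a = b := eq_of _ _ (by simpa [Multiset.insert_eq_cons] using hs)
    exact triv (by decide) (dbl a)
  · obtain ⟨a, b, c, rfl⟩ := Multiset.card_eq_three.1 hc
    obtain rfl : a + b = c := eq_of _ _ (by simpa [Multiset.insert_eq_cons, add_assoc] using hs)
    simp only [Multiset.insert_eq_cons, Multiset.mem_cons, Multiset.mem_singleton, not_or] at h0
    obtain ⟨ha, hb, hab⟩ := h0
    have hne : a ≠ b := fun h => hab (by rw [h, add_self_eq_zero_vec])
    -- The multiplicity 1 of `u` offsets the odd `t = 7`; translation by `u` swaps the other two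
    -- members.
    refine ⟨a, b, Ne.symm ha, Ne.symm hb, hne, ?_⟩
    have ha' : b ≠ a + b := fun h => ha (by simpa [eq_comm] using h)
    have hb' : a ≠ a + b := fun h => hb (by simpa [eq_comm] using h)
    rintro u (rfl | rfl) y hy hyu
    · simp only [Multiset.insert_eq_cons, Multiset.count_cons, Multiset.count_singleton,
        vec_add_eq_iff, add_self_eq_zero_vec, ← add_assoc, zero_add, hy, hyu, hne, hb', if_true,
        if_false]
      exact ⟨4 + (if y = b then 1 else 0) + (if y = u + b then 1 else 0), by ring⟩
    · simp only [Multiset.insert_eq_cons, Multiset.count_cons, Multiset.count_singleton,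
        vec_add_eq_iff, add_self_eq_zero_vec, add_left_comm u a u, add_zero, add_comm u a, hy, hyu,
        hne.symm, ha', if_true, if_false]
      exact ⟨4 + (if y = a then 1 else 0) + (if y = a + u then 1 else 0), by ring⟩
  · obtain rfl := Multiset.card_eq_zero.1 hc
    exact triv (by decide) (by simp)
  · obtain ⟨a, ha⟩ := Multiset.card_pos_iff_exists_mem.1 (hc ▸ four_pos)
    obtain ⟨s', rfl⟩ := Multiset.exists_cons_of_mem ha
    have hc' : s'.card = 3 := by simpa using hc
    obtain ⟨b, c, d, rfl⟩ := Multiset.card_eq_three.1 hc'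
    obtain rfl : a + b + c = d :=
      eq_of _ _ (by simpa [Multiset.insert_eq_cons, add_assoc] using hs)
    change 0 ∉ ({a, b, c, a + b + c} : Multiset _) at h0
    change ∃ p q : Fin 4 → ZMod 2, p ≠ 0 ∧ q ≠ 0 ∧ p ≠ q ∧ ∀ u, u = p ∨ u = q →
      ∀ y, y ≠ 0 → y ≠ u → Even (8 + Multiset.count u {a, b, c, a + b + c} +
        Multiset.count y {a, b, c, a + b + c} + Multiset.count (u + y) {a, b, c, a + b + c})
    have dbl' (x z y : Fin 4 → ZMod 2) : Even (Multiset.count y ({x, x} + {z, z})) := by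
      rw [Multiset.count_add]
      exact (dbl x y).add (dbl z y)
    by_cases hab : a = b
    · subst hab
      refine triv (by decide) fun x => ?_
      rw [add_self_eq_zero_vec, zero_add]
      exact dbl' a c x
    by_cases hac : a = c
    · subst hac
      refine triv (by decide) fun x => ?_
      rw [add_right_comm, add_self_eq_zero_vec, zero_add]
      have h := dbl' a b x
      simp only [Multiset.insert_eq_cons, Multiset.count_cons, Multiset.count_singleton,
        Multiset.count_add] at h ⊢
      convert h using 1
      ring
    by_cases hbc : b = c
    · subst hbc
      refine triv (by decide) fun x => ?_
      rw [add_assoc, add_self_eq_zero_vec, add_zero]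
      have h := dbl' a b x
      simp only [Multiset.insert_eq_cons, Multiset.count_cons, Multiset.count_singleton,
        Multiset.count_add] at h ⊢
      convert h using 1
      ring
    have hswap : ({a, b, c, a + b + c} : Multiset (Fin 4 → ZMod 2)) = {a, c, b, a + c + b} := by
      rw [add_right_comm a b c]
      exact congrArg _ (Multiset.cons_swap _ _ _)
    refine ⟨a + b, a + c, fun h => hab (eq_of _ _ h), fun h => hac (eq_of _ _ h),
      fun h => hbc (add_left_cancel h), ?_⟩
    rintro u (rfl | rfl) y - -
    · rw [count_of_plane_eq_zero h0, count_add_of_plane]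
      exact ⟨4 + Multiset.count y {a, b, c, a + b + c}, by ring⟩
    · rw [hswap] at h0 ⊢
      rw [count_of_plane_eq_zero h0, count_add_of_plane]
      exact ⟨4 + Multiset.count y {a, c, b, a + c + b}, by ring⟩

lemma exists_multiset_count_eq {α : Type*} [Fintype α] [DecidableEq α] [AddCommMonoid α]
    (f : α → ℕ) : ∃ s : Multiset α, (∀ x, s.count x = f x) ∧ s.card = ∑ x, f x ∧
      s.sum = ∑ x, f x • x := by
  refine ⟨∑ x, f x • {x}, fun x => ?_, ?_, ?_⟩
  · rw [Multiset.count_sum', sum_eq_single x]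
    · simp
    · intro y _ hy
      simp [hy.symm]
    · simp
  · rw [Multiset.card_sum]
    simp
  · rw [← Multiset.coe_sumAddMonoidHom, map_sum]
    simp only [map_nsmul, Multiset.coe_sumAddMonoidHom, Multiset.sum_singleton]

/-! ### Counting excess weight, and parity extension -/

section Columns

variable {ι : Type*} [Fintype ι]

lemma sum_colWeight_eq_of_excess {g : ι → Fin 4 → ZMod 2} {d : ℕ} {f : (Fin 4 → ZMod 2) → ℕ}
    (f0 : f 0 = 0) (hf : ∀ x ≠ 0, colWeight g x = d + f x) :
    ∑ x, colWeight g x = 15 * d + ∑ x, f x := by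
  rw [← add_sum_erase _ _ (mem_univ 0), ← add_sum_erase _ f (mem_univ 0), colWeight_zero, f0,
    zero_add, zero_add, sum_congr rfl fun x hx => hf x (ne_of_mem_erase hx), sum_add_distrib,
    sum_const, smul_eq_mul]
  congr 2

lemma excess_cases {n d F T z : ℕ} (hp : n = 23 ∧ d = 12 ∨ n = 27 ∧ d = 14 ∨ n = 31 ∧ d = 16)
    (htot : T = 15 * d + 2 * F) (hlen : T + 8 * z = 8 * n) :
    d / 2 = 6 ∧ F = 2 ∨ d / 2 = 7 ∧ F = 3 ∨ d / 2 = 8 ∧ F = 0 ∨ d / 2 = 8 ∧ F = 4 := by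
  rcases hp with ⟨rfl, rfl⟩ | ⟨rfl, rfl⟩ | ⟨rfl, rfl⟩ <;> omega

/-- Even codes with near-optimal parameters have a Gram form with radical of dimension at least
two. -/
lemma exists_pair_colGram_eq_zero {g : ι → Fin 4 → ZMod 2} {d : ℕ}
    (hp : Fintype.card ι = 23 ∧ d = 12 ∨ Fintype.card ι = 27 ∧ d = 14 ∨
      Fintype.card ι = 31 ∧ d = 16)
    (heven : ∀ x, Even (colWeight g x)) (hw : ∀ x ≠ 0, d ≤ colWeight g x) :
    ∃ a b : Fin 4 → ZMod 2, a ≠ 0 ∧ b ≠ 0 ∧ a ≠ b ∧ ∀ u, u = a ∨ u = b →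
      ∀ y, colGram g u y = 0 := by
  have hd : Even d := by rcases hp with h | h | h <;> rw [h.2] <;> decide
  obtain ⟨f, f0, hf⟩ : ∃ f : (Fin 4 → ZMod 2) → ℕ, f 0 = 0 ∧
      ∀ x ≠ 0, colWeight g x = d + 2 * f x := by
    refine ⟨fun x => (colWeight g x - d) / 2, by simp, fun x hx => ?_⟩
    have h1 := hw x hx
    obtain ⟨r, h2⟩ := heven x
    obtain ⟨q, h3⟩ := hd
    dsimp only
    omega
  have hsum := sum_nsmul_eq_zero hf
  have htot := sum_colWeight_eq_of_excess (f := fun x => 2 * f x) (by simp [f0]) hf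
  rw [← mul_sum] at htot
  have hlen := sum_colWeight g
  obtain ⟨s, hcount, hcard, hsz⟩ := exists_multiset_count_eq f
  rw [hsum] at hsz
  obtain ⟨a, b, ha, hb, hab, h⟩ := exists_pair_of_sum_eq_zero (s := s) (t := d / 2)
    (by rw [← Multiset.count_eq_zero, hcount, f0]) hsz (by rw [hcard]; exact excess_cases hp htot hlen)
  refine ⟨a, b, ha, hb, hab, fun u hu y => ?_⟩
  have hu0 : u ≠ 0 := by rcases hu with rfl | rfl <;> assumption
  by_cases hy : y = 0
  · rw [hy, colGram_zero_right]
  -- Half of `wt u + wt y - wt (u + y)` is `d / 2 + f u + f y - f (u + y)`, whence `t = d / 2`.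
  apply colGram_eq_zero_of_dvd
  by_cases hyu : y = u
  · obtain ⟨r, h2⟩ := heven u
    rw [hyu, add_self_eq_zero_vec, colWeight_zero, h2]
    unfold Nat.ModEq
    omega
  have huy : u + y ≠ 0 := fun h => hyu (by rw [CharTwo.add_eq_zero] at h; exact h.symm)
  have h2 := h u hu y hy hyu
  rw [hcount, hcount, hcount] at h2
  rw [hf _ hu0, hf _ hy, hf _ huy]
  obtain ⟨r, h2⟩ := h2
  unfold Nat.ModEq
  omega

/-- The columns of the extended code, obtained by adding an overall parity check. -/
def parityExtend (g : ι → Fin 4 → ZMod 2) (o : Option ι) : Fin 4 → ZMod 2 := o.elim (∑ i, g i) g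

lemma colWeight_parityExtend (g : ι → Fin 4 → ZMod 2) (x : Fin 4 → ZMod 2) :
    colWeight (parityExtend g) x = colWeight g x + if Even (colWeight g x) then 0 else 1 := by
  simp only [even_colWeight_iff]
  rw [colWeight_eq_sum, colWeight_eq_sum, Fintype.sum_option, add_comm]
  change _ + (if (∑ i, g i) ⬝ᵥ x ≠ 0 then 1 else 0) = _
  rw [ite_not]
  rfl

lemma even_colWeight_parityExtend (g : ι → Fin 4 → ZMod 2) (x : Fin 4 → ZMod 2) :
    Even (colWeight (parityExtend g) x) := by
  rw [colWeight_parityExtend]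
  split_ifs with h
  · exact h
  · exact (Nat.not_even_iff_odd.1 h).add_one

lemma colGram_parityExtend (g : ι → Fin 4 → ZMod 2) (x y : Fin 4 → ZMod 2) :
    colGram (parityExtend g) x y =
      ((∑ i, g i) ⬝ᵥ x) * ((∑ i, g i) ⬝ᵥ y) + colGram g x y := by
  simp [colGram, Fintype.sum_option, parityExtend]

lemma exists_colGram_eq_zero_of_parityExtend {g : ι → Fin 4 → ZMod 2} {d : ℕ}
    (hp : Fintype.card ι = 22 ∧ d = 11 ∨ Fintype.card ι = 26 ∧ d = 13 ∨
      Fintype.card ι = 30 ∧ d = 15)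
    (hw : ∀ x ≠ 0, d ≤ colWeight g x) :
    ∃ u : Fin 4 → ZMod 2, u ≠ 0 ∧ ∀ y, colGram g u y = 0 := by
  obtain ⟨a, b, ha, hb, hab, h⟩ := exists_pair_colGram_eq_zero (g := parityExtend g)
    (d := d + 1) (by rw [Fintype.card_option]; omega) (even_colWeight_parityExtend g)
    (fun x hx => by
      have h1 := hw x hx
      have h2 := even_colWeight_parityExtend g x
      rw [colWeight_parityExtend] at h2 ⊢
      obtain ⟨r, h2⟩ := h2
      omega)
  have main (u : Fin 4 → ZMod 2) (hu : ∀ y, colGram (parityExtend g) u y = 0)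
      (hp : (∑ i, g i) ⬝ᵥ u = 0) (y) : colGram g u y = 0 := by
    have := hu y
    rwa [colGram_parityExtend, hp, zero_mul, zero_add] at this
  have h1 : ∀ c : ZMod 2, c = 0 ∨ c = 1 := by decide
  rcases h1 ((∑ i, g i) ⬝ᵥ a) with pa | pa
  · exact ⟨a, ha, main a (h a (.inl rfl)) pa⟩
  rcases h1 ((∑ i, g i) ⬝ᵥ b) with pb | pb
  · exact ⟨b, hb, main b (h b (.inr rfl)) pb⟩
  -- Both parities are 1, so they cancel on the sum.
  refine ⟨a + b, fun h0 => hab (by rwa [CharTwo.add_eq_zero] at h0), main _ (fun y => ?_) ?_⟩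
  · rw [colGram_add_left, h a (.inl rfl), h b (.inr rfl), add_zero]
  · rw [dotProduct_add, pa, pb]
    decide

lemma exists_ne_zero_dotProduct_eq_zero :
    ∀ v : Fin 4 → ZMod 2, ∃ u : Fin 4 → ZMod 2, u ≠ 0 ∧ v ⬝ᵥ u = 0 := by
  decide +kernel

/-- If some weight is odd, exactly 8 are, each at least `d + 1`. Then `15 * d + 8 ≤ 8 * n`, which
fails except for equality at (31,16). -/
lemma exists_colGram_eq_zero_of_even_minWeight {g : ι → Fin 4 → ZMod 2} {d : ℕ}
    (hp : Fintype.card ι = 23 ∧ d = 12 ∨ Fintype.card ι = 27 ∧ d = 14 ∨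
      Fintype.card ι = 31 ∧ d = 16)
    (hw : ∀ x ≠ 0, d ≤ colWeight g x) :
    ∃ u : Fin 4 → ZMod 2, u ≠ 0 ∧ ∀ y, colGram g u y = 0 := by
  by_cases hs : ∑ i, g i = 0
  · obtain ⟨a, b, ha, -, -, h⟩ := exists_pair_colGram_eq_zero hp
      (fun x => by rw [even_colWeight_iff, hs, zero_dotProduct]) hw
    exact ⟨a, ha, h a (.inl rfl)⟩
  obtain ⟨p, hpdef⟩ : ∃ p : (Fin 4 → ZMod 2) → ℕ,
    p = fun x => if (∑ i, g i) ⬝ᵥ x ≠ 0 then 1 else 0 := ⟨_, rfl⟩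
  have hd : Even d := by rcases hp with h | h | h <;> rw [h.2] <;> decide
  have hle (x) (hx : x ≠ 0) : d + p x ≤ colWeight g x := by
    have h1 := hw x hx
    have h2 := even_colWeight_iff g x
    rw [hpdef]
    dsimp only
    split_ifs with h
    · rw [ne_eq, ← h2] at h
      exact h1.lt_of_ne fun h3 => h (h3 ▸ hd)
    · exact h1
  have hpsum : ∑ x, p x = 8 := by
    rw [hpdef, ← card_filter]
    exact card_dotProduct_ne_zero _ hs
  obtain ⟨e, he0, he⟩ : ∃ e : (Fin 4 → ZMod 2) → ℕ, e 0 = 0 ∧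
      ∀ x ≠ 0, colWeight g x = d + (p x + e x) :=
    ⟨fun x => colWeight g x - (d + p x), by simp, fun x hx => by
      have := hle x hx
      dsimp only
      omega⟩
  have htot := sum_colWeight_eq_of_excess (f := fun x => p x + e x) (by simp [hpdef, he0]) he
  rw [sum_add_distrib, hpsum] at htot
  have hlen := sum_colWeight g
  have hd16 : d = 16 := by omega
  have hesum : ∑ x, e x = 0 := by omega
  have hw' (x) (hx : x ≠ 0) : colWeight g x = 16 + p x := by
    rw [he x hx, hd16, sum_eq_zero_iff.1 hesum x (mem_univ x), add_zero]
  obtain ⟨u, hu, hpu⟩ := exists_ne_zero_dotProduct_eq_zero (∑ i, g i)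
  refine ⟨u, hu, fun y => ?_⟩
  by_cases hy : y = 0
  · rw [hy, colGram_zero_right]
  have hpu' : p u = 0 := by simp [hpdef, hpu]
  apply colGram_eq_zero_of_dvd
  by_cases huy : u + y = 0
  · rw [CharTwo.add_eq_zero] at huy
    rw [← huy, add_self_eq_zero_vec, colWeight_zero, hw' u hu, hpu']
    decide
  · have hpy : p (u + y) = p y := by simp [hpdef, hpu, dotProduct_add]
    rw [hw' u hu, hw' y hy, hw' _ huy, hpu', hpy]
    unfold Nat.ModEq
    omega

end Columns

/-- An LCD code of dimension four has a nonsingular Gram form on the columns of a generator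
matrix. -/
lemma exists_columns {n d : ℕ} {C : BinaryCode n} (hC : C.HasParams 4 d) (hL : C.IsLCD) :
    ∃ g : Fin n → Fin 4 → ZMod 2, (∀ x ≠ 0, d ≤ colWeight g x) ∧
      ∀ u, (∀ y, colGram g u y = 0) → u = 0 := by
  obtain ⟨hdim, -, hmin⟩ := hC
  have B := Module.finBasisOfFinrankEq (ZMod 2) C hdim
  have hcoord (x : Fin 4 → ZMod 2) (i : Fin n) :
      (fun j => (B j : Fin n → ZMod 2) i) ⬝ᵥ x = (B.equivFun.symm x : Fin n → ZMod 2) i := by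
    rw [Module.Basis.equivFun_symm_apply]
    simp [dotProduct, Finset.sum_apply, mul_comm]
  refine ⟨fun i j => (B j : Fin n → ZMod 2) i, fun x hx => hmin ?_, fun u hu => ?_⟩
  · refine ⟨B.equivFun.symm x, (B.equivFun.symm x).2, fun h => hx (B.equivFun.symm.map_eq_zero_iff.1 (Subtype.ext h)), ?_⟩
    simp only [hammingNorm, colWeight, hcoord]
  · have hmem : (B.equivFun.symm u : Fin n → ZMod 2) ∈ C ⊓ C.dual := by
      refine ⟨(B.equivFun.symm u).2, fun y hy => ?_⟩
      have h := hu (B.equivFun ⟨y, hy⟩)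
      simp only [colGram, hcoord, LinearEquiv.symm_apply_apply] at h
      exact h
    rw [show C ⊓ C.dual = ⊥ from hL, Submodule.mem_bot] at hmem
    exact B.equivFun.symm.map_eq_zero_iff.1 (Subtype.ext hmem)

end BinaryCode

open BinaryCode in
theorem mainTheorem3 (n d : ℕ)
    (hnd : (n, d) ∈ ({(22, 11), (23, 12), (26, 13), (27, 14), (30, 16), (30, 15), (31, 16)} :
      Set (ℕ × ℕ))) :
    ¬ ∃ C : BinaryCode n, C.HasParams 4 d ∧ C.IsLCD := by
  rintro ⟨C, hC, hL⟩
  obtain ⟨g, hw, hg⟩ := exists_columns hC hL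
  have key (h : ∃ u : Fin 4 → ZMod 2, u ≠ 0 ∧ ∀ y, colGram g u y = 0) : False := by
    obtain ⟨u, hu, h⟩ := h
    exact hu (hg u h)
  simp only [Set.mem_insert_iff, Set.mem_singleton_iff, Prod.mk.injEq] at hnd
  have hcard := Fintype.card_fin n
  by_cases h : n = 22 ∨ n = 26 ∨ n = 30
  -- Only the bound `d ≤ wt` is used, so (30,16) is covered by (30,15).
  · refine key (exists_colGram_eq_zero_of_parityExtend (d := if d = 16 then 15 else d) ?_
      fun x hx => le_trans ?_ (hw x hx))
    · rw [hcard]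
      split_ifs <;> omega
    · split_ifs <;> omega
  · exact key (exists_colGram_eq_zero_of_even_minWeight (d := d) (by rw [hcard]; omega) hw)
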